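/- All rings are associative. Let $S$ be a unital ring. An element $u\in S$ is quasi-invertible, written $u\in S_q^{-1}$, if there is $v\in S$ with $(1-uv)S(1-vu)=0=(1-vu)S(1-uv)$; let $S_l^{-1}$ and $S_r^{-1}$ denote the sets of left and of right invertible elements of $S$. The ring $S$ is a QB-ring if, whenever $a,b\in S$ satisfy $Sa+Sb=S$, there is $y\in S$ such that $a+yb\in S_q^{-1}$. Let $A$ be a ring, not necessarily unital. $A$ is an exchange ring if for every $x\in A$ there are an idempotent $p\in xA$ and an element $s\in A$ with $p=x+s-xs$. Idempotents $e,f\in A$ are equivalent if $e=xy$ and $f=yx$ for some $x\in eAf$ and $y\in fAe$. A non-zero idempotent $p\in A$ is infinite if it is equivalent to an idempotent $q\neq p$ with $pq=qp=q$. $A$ is purely infinite simple if it is simple (that is, $A\ne 0$ and its only two-sided ideals are $0$ and $A$) and every non-zero right ideal of $A$ contains an infinite idempotent. A two-sided ideal $I$ of a unital ring $R$ is essential if $I\cap J\neq 0$ for every non-zero two-sided ideal $J$ of $R$. **Theorem.** Let $R$ be a unital ring and let $I$ be an essential two-sided ideal of $R$ which, regarded as a (not necessarily unital) ring, is purely infinite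 simple and an exchange ring. Then $R$ is a QB-ring if and only if $R/I$ is a QB-ring and $(R/I)_q^{-1}=(R/I)_r^{-1}\cup(R/I)_l^{-1}$. -/

import Mathlib

namespace QBRings

section Unital

variable {R : Type*} [Ring R]

/-- `x ⟂ y`: the elements are centrally orthogonal, that is, `x R y = 0 = y R x`. -/
def CentrallyOrthogonal (x y : R) : Prop :=
  ∀ r : R, x * r * y = 0 ∧ y * r * x = 0

/-- `u` is quasi-invertible: `(1 - u v) ⟂ (1 - v u)` for some `v`. -/
def IsQuasiInvertible (u : R) : Prop :=
  ∃ v : R, CentrallyOrthogonal (1 - u * v) (1 - v * u)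

variable (R)

/-- The set `R_q⁻¹` of quasi-invertible elements. -/
def quasiInvertibles : Set R := {u | IsQuasiInvertible u}

/-- The set `R_l⁻¹` of left invertible elements. -/
def leftInvertibles : Set R := {u | ∃ v : R, v * u = 1}

/-- The set `R_r⁻¹` of right invertible elements. -/
def rightInvertibles : Set R := {u | ∃ v : R, u * v = 1}

/-- `R` is a QB-ring: whenever `R a + R b = R`, there is `y` with `a + y b` quasi-invertible.
(`Ideal.span {a}` is the left ideal `R a`.) -/
def IsQBRing : Prop :=
  ∀ a b : R, Ideal.span {a} ⊔ Ideal.span {b} = ⊤ → ∃ y : R, a + y * b ∈ quasiInvertibles R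

end Unital

section NonUnital

variable {A : Type*} [NonUnitalRing A]

/-- Murray-von Neumann equivalence of idempotents: `e = x y` and `f = y x` with `x ∈ e A f` and
`y ∈ f A e`. -/
def MvNEquiv (e f : A) : Prop :=
  ∃ x y : A, (∃ a, x = e * a * f) ∧ (∃ b, y = f * b * e) ∧ e = x * y ∧ f = y * x

/-- `p` is an infinite idempotent: a non-zero idempotent equivalent to an idempotent `q < p`. -/
def IsInfiniteIdempotent (p : A) : Prop :=
  p ≠ 0 ∧ IsIdempotentElem p ∧
    ∃ q : A, IsIdempotentElem q ∧ q * p = q ∧ p * q = q ∧ q ≠ p ∧ MvNEquiv q p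

/-- An additive subgroup of a possibly non-unital ring is a right ideal. -/
def IsRightIdeal (J : AddSubgroup A) : Prop := ∀ x ∈ J, ∀ a : A, x * a ∈ J

variable (A)

/-- A simple ring (possibly without unit) is purely infinite if every non-zero right ideal
contains an infinite idempotent. -/
def IsPurelyInfiniteSimple : Prop :=
  IsSimpleRing A ∧
    ∀ J : AddSubgroup A, IsRightIdeal J → J ≠ ⊥ → ∃ p ∈ J, IsInfiniteIdempotent p

/-- Exchange ring, not necessarily unital: for each `x` there is an idempotent `p ∈ x A` of the
form `p = x + s - x s`. -/
def IsExchangeRing : Prop :=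
  ∀ x : A, ∃ p r s : A, IsIdempotentElem p ∧ p = x * r ∧ p = x + s - x * s

end NonUnital

/-- A two-sided ideal is essential if it meets every non-zero two-sided ideal non-trivially. -/
def IsEssentialIdeal {R : Type*} [Ring R] (I : TwoSidedIdeal R) : Prop :=
  ∀ J : TwoSidedIdeal R, J ≠ ⊥ → I ⊓ J ≠ ⊥

end QBRings

/-! An essential simple ideal `I` lies in every non-zero ideal, and it contains a non-zero
idempotent, so `R` is prime and its quasi-invertible elements are one-sided invertible. If `R` is
QB, a quasi-invertible element of `R/I` lifts, up to a unit factor, to one of `R`, so it is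
one-sided invertible too.

Conversely, the QB property of `R/I` changes `a` by a left multiple of `b` until it is one-sided
invertible modulo `I`. Exchange turns the defect into an idempotent `p ∈ I`. Pure infiniteness makes
`p` factor through every non-zero element (`exists_eq_mul_mul`), so a further left multiple of `b`
repairs the defect: `exists_isQuasiInvertible_add_mul` and `exists_isQuasiInvertible_add_mul'`. -/

namespace QBRings

/-! ### Quasi-invertible elements -/

section Unital

variable {R : Type*} [Ring R]

/-- The defining condition on comaximal pairs in a QB-ring, with explicit coefficients. -/
theorem isQBRing_iff :
    IsQBRing R ↔ ∀ a b x z : R, x * a + z * b = 1 → ∃ y, IsQuasiInvertible (a + y * b) := by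
  have key (a b : R) : Ideal.span {a} ⊔ Ideal.span {b} = ⊤ ↔ ∃ x z : R, x * a + z * b = 1 := by
    simp [Ideal.eq_top_iff_one, Submodule.mem_sup, Ideal.mem_span_singleton']
  refine ⟨fun h a b x z hxz ↦ h a b ((key a b).2 ⟨x, z, hxz⟩), fun h a b hab ↦ ?_⟩
  obtain ⟨x, z, hxz⟩ := (key a b).1 hab
  exact h a b x z hxz

theorem isQuasiInvertible_of_mul_eq_one {u v : R} (h : u * v = 1) : IsQuasiInvertible u :=
  ⟨v, fun r ↦ by simp [h]⟩

theorem isQuasiInvertible_of_mul_eq_one' {u v : R} (h : v * u = 1) : IsQuasiInvertible u :=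
  ⟨v, fun r ↦ by simp [h]⟩

/-- A quasi-inverse `v` of `u` can be chosen with `u v u = u` and `v u v = v`. -/
theorem IsQuasiInvertible.exists_regular {u : R} (h : IsQuasiInvertible u) :
    ∃ v, CentrallyOrthogonal (1 - u * v) (1 - v * u) ∧ v * u * v = v := by
  obtain ⟨v, hv⟩ := h
  have h0 : (1 - u * v) * u * (1 - v * u) = 0 := (hv u).1
  -- Chosen so that `1 - u w` and `1 - w u` are the squares of the old defects; then `u w u = u`,
  -- and `w u w` is the regular quasi-inverse.
  set w := 2 * v - v * u * v with hw
  have h1 : 1 - u * w = (1 - u * v) * (1 - u * v) := by rw [hw]; noncomm_ring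
  have h2 : 1 - w * u = (1 - v * u) * (1 - v * u) := by rw [hw]; noncomm_ring
  have huwu : u * w * u = u := by
    have : u - u * w * u = (1 - u * v) * u * (1 - v * u) := by rw [hw]; noncomm_ring
    rw [h0] at this
    exact (sub_eq_zero.1 this).symm
  refine ⟨w * u * w, fun r ↦ ?_, ?_⟩
  · have e1 : u * (w * u * w) = u * w := by rw [← mul_assoc, ← mul_assoc, huwu]
    have e2 : w * u * w * u = w * u := by rw [mul_assoc (w * u), mul_assoc w u, ← mul_assoc u, huwu]
    rw [e1, e2, h1, h2]
    constructor
    · calc _ = (1 - u * v) * ((1 - u * v) * r * (1 - v * u)) * (1 - v * u) := by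
            simp only [mul_assoc]
        _ = 0 := by rw [(hv r).1]; simp
    · calc _ = (1 - v * u) * ((1 - v * u) * r * (1 - u * v)) * (1 - u * v) := by
            simp only [mul_assoc]
        _ = 0 := by rw [(hv r).2]; simp
  · have e : w * u * w * u = w * u := by
      rw [mul_assoc (w * u), mul_assoc w u, ← mul_assoc u, huwu]
    calc w * u * w * u * (w * u * w) = w * u * w * u * w := by
          rw [e, ← mul_assoc, ← mul_assoc, e]
      _ = w * u * w := by rw [e]

/-- If `u + y (1 - v u)` is one-sided invertible, where `v` is a quasi-inverse of `u`, then `u` is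
one-sided invertible on the same side. -/
theorem exists_unit_mul_eq {u v : R} (h : CentrallyOrthogonal (1 - u * v) (1 - v * u))
    (hv : v * u * v = v) (y : R) : ∃ s : Rˣ, u + y * (1 - v * u) = u * s := by
  -- `(1 - v u) v = 0` forces `n² = 0`, so `1 + n` is the unit sought.
  set n := v * y * (1 - v * u) with hn
  have hnn : n * n = 0 := by
    have : n * n = v * y * (v - v * u * v) * y * (1 - v * u) := by rw [hn]; noncomm_ring
    rw [this, hv]; simp
  refine ⟨⟨1 + n, 1 - n, ?_, ?_⟩, ?_⟩
  · have : (1 + n) * (1 - n) = 1 - n * n := by noncomm_ring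
    rw [this, hnn, sub_zero]
  · have : (1 - n) * (1 + n) = 1 - n * n := by noncomm_ring
    rw [this, hnn, sub_zero]
  · have h0 := (h y).1
    have : u + y * (1 - v * u) = u * (1 + n) + (1 - u * v) * y * (1 - v * u) := by
      rw [hn]; noncomm_ring
    rw [this, h0, add_zero]

/-! ### Exchange symmetry and infinite idempotents -/

/-- Left-right symmetry of the exchange condition: from an idempotent in `b R` whose complement is
in `(1 - b) R` one obtains an idempotent in `R b` whose complement is in `R (1 - b)`. -/
theorem exists_isIdempotentElem_left {b r s : R} (hp : IsIdempotentElem (b * r))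
    (hs : 1 - b * r = (1 - b) * s) :
    ∃ u v : R, IsIdempotentElem (u * b) ∧ 1 - u * b = v * (1 - b) := by
  set p := b * r with hpdef
  set q := 1 - p with hq
  have hqq : IsIdempotentElem q := hp.one_sub
  set r' := r * p with hr'
  have hpq : p * q = 0 := by rw [hq, mul_sub, mul_one, hp.eq, sub_self]
  set s' := s * q with hs'
  have hbr : b * r' = p := by rw [hr', ← mul_assoc, ← hpdef, hp.eq]
  have has : (1 - b) * s' = q := by rw [hs', ← mul_assoc, ← hs, hqq.eq]
  have hrq : r' * q = 0 := by rw [hr', mul_assoc, hpq, mul_zero]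
  have hsq : s' * q = s' := by rw [hs', mul_assoc, hqq.eq]
  -- With these, `1 - u b = v (1 - b)` is formal, while `b v = s' b` and `u s' = 0` give `u b (1 - u
  -- b) = 0`.
  set u := 1 + (r' - s') * (1 - b) with hu
  set v := 1 - (r' - s') * b with hv
  have hsum : 1 - u * b = v * (1 - b) := by rw [hu, hv]; noncomm_ring
  have hbs : b * s' = s' - q := by rw [← has]; noncomm_ring
  have hus : u * s' = 0 := by
    have : u * s' = s' + r' * ((1 - b) * s') - s' * ((1 - b) * s') := by rw [hu]; noncomm_ring
    rw [this, has, hrq, hsq]; simp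
  have hbv : b * v = s' * b := by
    have : b * v = b - b * r' * b + b * s' * b := by rw [hv]; noncomm_ring
    rw [this, hbr, hbs, hq]; noncomm_ring
  refine ⟨u, v, ?_, hsum⟩
  have h0 : u * b * (1 - u * b) = 0 := by
    calc u * b * (1 - u * b) = u * (b * v) * (1 - b) := by rw [hsum]; simp only [mul_assoc]
      _ = u * s' * b * (1 - b) := by rw [hbv]; simp only [mul_assoc]
      _ = 0 := by rw [hus]; simp
  rw [mul_sub, mul_one, sub_eq_zero] at h0
  exact h0.symm

/-- If `p = y x` and `q = x y` is a proper subidempotent of `p`, then every element of the ideal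
generated by `p - q` factors through `p`. -/
theorem exists_eq_mul_mul_of_mem_span {p x y : R} (hp : p * p = p) (hyx : y * x = p)
    (hpx : p * x = x) (hxp : x * p = x) (hyp : y * p = y) (hpy : p * y = y) {z : R}
    (hz : z ∈ TwoSidedIdeal.span {p - x * y}) : ∃ a b : R, z = a * p * b := by
  have hpxn (n : ℕ) : p * x ^ (n + 1) = x ^ (n + 1) := by rw [pow_succ', ← mul_assoc, hpx]
  have hynp (n : ℕ) : y ^ (n + 1) * p = y ^ (n + 1) := by rw [pow_succ, mul_assoc, hyp]
  have hypx (n : ℕ) : y ^ n * p * x ^ n = p := by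
    induction n with
    | zero => simp
    | succ n ih =>
      rw [hynp, pow_succ, pow_succ', ← mul_assoc, mul_assoc (y ^ n), hyx, ih]
  have hyxx (n : ℕ) : y ^ n * x ^ n * x = x := by
    cases n with
    | zero => simp
    | succ n => rw [← hynp, hypx, hpx]
  have hyyx (n : ℕ) : y * (y ^ n * x ^ n) = y := by
    cases n with
    | zero => simp
    | succ n => rw [← hynp, hypx, hyp]
  -- The two vanishing conditions make sums work: shifting the second summand by `y ^ n` and `x ^ n`
  -- kills the cross terms, and `y ^ n p x ^ n = p` preserves it.
  suffices ∃ (n : ℕ) (a b : R), z = a * p * b ∧ a * x ^ n = 0 ∧ y ^ n * b = 0 by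
    obtain ⟨-, a, b, h, -⟩ := this
    exact ⟨a, b, h⟩
  induction hz using TwoSidedIdeal.span_induction with
  | mem f hf =>
    rw [Set.mem_singleton_iff] at hf
    have hfp : f * p = f := by rw [hf, sub_mul, hp, mul_assoc, hyp]
    have hfx : f * x = 0 := by rw [hf, sub_mul, hpx, mul_assoc, hyx, hxp, sub_self]
    have hyf : y * f = 0 := by rw [hf, mul_sub, hyp, ← mul_assoc, hyx, hpy, sub_self]
    refine ⟨1, f, f, ?_, by simpa using hfx, by simpa using hyf⟩
    rw [hfp, hf, sub_mul, mul_sub, hp, ← mul_assoc p, hpx, ← hf, mul_assoc x, hyf, mul_zero,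
      sub_zero]
  | zero => exact ⟨0, 0, 0, by simp, by simp, by simp⟩
  | add u v _ _ hu hv =>
    obtain ⟨n, a, b, rfl, han, hbn⟩ := hu
    obtain ⟨m, c, d, rfl, hcm, hdm⟩ := hv
    have h1 : a * p * x ^ n = 0 := by
      cases n with
      | zero => simp_all
      | succ n => rw [mul_assoc, hpxn, han]
    have h2 : y ^ n * p * b = 0 := by
      cases n with
      | zero => simp_all
      | succ n => rw [hynp, hbn]
    have h3 : c * (y ^ n * x ^ n * x ^ m) = 0 := by
      cases m with
      | zero => simp_all
      | succ m => rw [pow_succ', ← mul_assoc _ x, hyxx, ← pow_succ', hcm]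
    have h4 : y ^ m * (y ^ n * x ^ n) * d = 0 := by
      cases m with
      | zero => simp_all
      | succ m => rw [pow_succ, mul_assoc (y ^ m), hyyx, ← pow_succ, hdm]
    refine ⟨n + m, a + c * y ^ n, b + x ^ n * d, ?_, ?_, ?_⟩
    · calc a * p * b + c * p * d
          = a * p * b + a * p * x ^ n * d + c * (y ^ n * p * b) + c * (y ^ n * p * x ^ n) * d := by
            rw [h1, h2, hypx]; simp
        _ = _ := by noncomm_ring
    · calc _ = a * x ^ n * x ^ m + c * (y ^ n * x ^ n * x ^ m) := by
            rw [pow_add]; noncomm_ring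
        _ = 0 := by rw [han, h3]; simp
    · calc _ = y ^ m * (y ^ n * b) + y ^ m * (y ^ n * x ^ n) * d := by
            rw [add_comm n m, pow_add]; noncomm_ring
        _ = 0 := by rw [hbn, h4]; simp
  | neg u _ hu =>
    obtain ⟨n, a, b, rfl, h1, h2⟩ := hu
    exact ⟨n, -a, b, by simp, by simp [h1], h2⟩
  | left_absorb c u _ hu =>
    obtain ⟨n, a, b, rfl, h1, h2⟩ := hu
    exact ⟨n, c * a, b, by simp only [mul_assoc], by rw [mul_assoc, h1, mul_zero], h2⟩
  | right_absorb c u _ hu =>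
    obtain ⟨n, a, b, rfl, h1, h2⟩ := hu
    exact ⟨n, a, b * c, by simp only [mul_assoc], h1, by rw [← mul_assoc, h2, zero_mul]⟩

/-! ### Completing to one-sided invertible elements -/

/-- If the idempotents `t a = 1 - p` and `p` are complementary and `p` factors through every
non-zero element, then `a (1 - p)` is one-sided invertible modulo `R p`. -/
theorem exists_isQuasiInvertible_add_mul {a t p : R} (hp : IsIdempotentElem p)
    (hta : t * a = 1 - p) (hfac : ∀ c : R, c ≠ 0 → ∃ x y : R, p = x * c * y) :
    ∃ w : R, IsQuasiInvertible (a + w * p) := by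
  set q := 1 - p with hq
  have hqq : q * q = q := hp.one_sub.eq
  set a' := a * q with ha'
  set t' := q * t with ht'
  have hta' : t' * a' = q := by
    rw [ha', ht', mul_assoc, ← mul_assoc t, hta, hqq, hqq]
  have haa' : a' = a + (-a) * p := by rw [ha', hq]; noncomm_ring
  have ha'q : a' * q = a' := by rw [ha', mul_assoc, hqq]
  have hqt' : q * t' = t' := by rw [ht', ← mul_assoc, hqq]
  set g := 1 - a' * t' with hg
  have htg : t' * g = 0 := by
    rw [hg, mul_sub, ← mul_assoc, hta', hqt', mul_one, sub_self]
  have hga : g * a' = 0 := by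
    rw [hg, sub_mul, mul_assoc, hta', ha'q, one_mul, sub_self]
  have hgg : g * g = g := by
    conv_lhs => enter [2]; rw [hg]
    rw [mul_sub, ← mul_assoc, hga, mul_one, zero_mul, sub_zero]
  by_cases hg0 : g = 0
  · refine ⟨-a, ?_⟩
    rw [← haa']
    exact isQuasiInvertible_of_mul_eq_one (sub_eq_zero.1 hg0).symm
  obtain ⟨x, y, hxy⟩ := hfac g hg0
  -- `-a` erases `a p`; `g y` sends the corner of `p` into the complement `g` of the range of `a'`.
  refine ⟨-a + g * y, isQuasiInvertible_of_mul_eq_one' (v := t' + p * x * g) ?_⟩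
  have : a + (-a + g * y) * p = a' + g * y * p := by rw [haa']; noncomm_ring
  rw [this]
  calc _ = t' * a' + t' * g * y * p + p * x * (g * a') + p * (x * (g * g) * y) * p := by
        noncomm_ring
    _ = 1 := by
        rw [hta', htg, hga, hgg, ← hxy, hp.eq, hp.eq, hq]; simp

/-- If `a t = 1 - p` for an idempotent `p` which factors through every non-zero element, then every
`b` with `R a + R b = R` allows to complete `a` to a one-sided invertible element. -/
theorem exists_isQuasiInvertible_add_mul' {a t p b x z : R} (hp : IsIdempotentElem p)
    (hat : a * t = 1 - p) (hab : x * a + z * b = 1)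
    (hfac : ∀ c : R, c ≠ 0 → ∃ x y : R, p = x * c * y) :
    ∃ w : R, IsQuasiInvertible (a + w * b) := by
  set q := 1 - p with hq
  have hqq : q * q = q := hp.one_sub.eq
  have hqp : q * p = 0 := by rw [hq, sub_mul, one_mul, hp.eq, sub_self]
  set t' := t * q with ht'
  have hat' : a * t' = q := by rw [ht', ← mul_assoc, hat, hqq]
  have htp : t' * p = 0 := by rw [ht', mul_assoc, hqp, mul_zero]
  have htq : t' * q = t' := by rw [ht', mul_assoc, hqq]
  set h := 1 - t' * a with hh
  have hht : h * t' = 0 := by rw [hh, sub_mul, mul_assoc, hat', htq, one_mul, sub_self]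
  have hhh : h * h = h := by
    conv_lhs => enter [2]; rw [hh]
    rw [mul_sub, ← mul_assoc, hht, mul_one, zero_mul, sub_zero]
  have hah : q * a * h = 0 := by
    rw [hh, mul_sub, mul_one, mul_assoc q a, ← mul_assoc a, hat', ← mul_assoc, hqq, sub_self]
  by_cases hb : b * h = 0
  · refine ⟨0, isQuasiInvertible_of_mul_eq_one' (v := x + z * b * t') ?_⟩
    have hb' : b = b * t' * a := by
      rw [hh, mul_sub, mul_one, ← mul_assoc, sub_eq_zero] at hb
      exact hb
    rw [zero_mul, add_zero, add_mul, ← hab]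
    conv_rhs => rw [hb']
    simp only [mul_assoc]
  obtain ⟨w, k, hwk⟩ := hfac _ hb
  obtain ⟨k', hk'⟩ : ∃ k', k' = h * k * p := ⟨_, rfl⟩
  -- The term `-p a k'` cancels the contribution of `p a`, so that `t' + k'` is a right inverse of
  -- `a + y b h`.
  obtain ⟨y, hy⟩ : ∃ y, y = (p - p * a * k') * w := ⟨_, rfl⟩
  have hpy : p * y = y := by
    rw [hy, ← mul_assoc, mul_sub, ← mul_assoc p, ← mul_assoc p, hp.eq]
  have hbk : w * (b * h) * k' = p := by
    calc _ = w * (b * (h * h)) * k * p := by rw [hk']; simp only [mul_assoc]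
      _ = p := by rw [hhh, ← hwk, hp.eq]
  have hyb : (p * a + y * (b * h)) * k' = p := by
    have hkp : k' * p = k' := by rw [hk', mul_assoc, hp.eq]
    calc _ = p * a * k' + (p - p * a * k') * (w * (b * h) * k') := by rw [hy]; noncomm_ring
      _ = p * a * k' + p * p - p * a * (k' * p) := by rw [hbk]; noncomm_ring
      _ = p := by rw [hkp, hp.eq]; noncomm_ring
  have hqa : q * a * k' = 0 := by
    rw [hk', ← mul_assoc, ← mul_assoc, hah, zero_mul, zero_mul]
  have hnil : y * b * t' * (y * b * t') = 0 := by
    calc _ = y * b * t' * (p * y * b * t') := by rw [hpy]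
      _ = y * b * (t' * p) * (y * b * t') := by simp only [mul_assoc]
      _ = 0 := by rw [htp]; simp
  have hright : (a + y * (b * h)) * (t' + k') = 1 := by
    calc _ = a * t' + y * b * (h * t') + q * a * k' + (p * a + y * (b * h)) * k' := by
          rw [hq]; noncomm_ring
      _ = 1 := by rw [hat', hht, hqa, hyb, hq]; simp
  have hinv : (1 + y * b * t') * (1 - y * b * t') = 1 := by
    have : (1 + y * b * t') * (1 - y * b * t') = 1 - y * b * t' * (y * b * t') := by
      noncomm_ring
    rw [this, hnil, sub_zero]
  -- `a + y b h = (1 - y b t') a + y b` is not `a` plus a left multiple of `b`; multiplying by the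
  -- unit `1 + y b t'` makes it one.
  refine ⟨(1 + y * b * t') * y,
    isQuasiInvertible_of_mul_eq_one (v := (t' + k') * (1 - y * b * t')) ?_⟩
  have hfactor : a + (1 + y * b * t') * y * b = (1 + y * b * t') * (a + y * (b * h)) := by
    have h1 : a + y * (b * h) = (1 - y * b * t') * a + y * b := by rw [hh]; noncomm_ring
    rw [h1, mul_add, ← mul_assoc (1 + y * b * t'), hinv, one_mul, mul_assoc _ y b]
  rw [hfactor]
  calc _ = (1 + y * b * t') * ((a + y * (b * h)) * (t' + k')) * (1 - y * b * t') := by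
        simp only [mul_assoc]
    _ = 1 := by rw [hright, mul_one, hinv]

end Unital

/-! ### Essential purely infinite simple ideals -/

section Ideal

variable {R : Type*} [Ring R] {I : TwoSidedIdeal R}

/-- The trace of `J` on `I` is an ideal of the ring `I`, non-zero by essentiality, hence everything
by simplicity. -/
theorem le_of_ne_bot (hs : IsSimpleRing I) (hess : IsEssentialIdeal I) {J : TwoSidedIdeal R}
    (hJ : J ≠ ⊥) : I ≤ J := by
  let f : I →ₙ+* R :=
    { toFun := Subtype.val, map_mul' := fun _ _ ↦ rfl, map_zero' := rfl, map_add' := fun _ _ ↦ rfl }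
  have hcomap : TwoSidedIdeal.comap f J = ⊤ := by
    refine (eq_bot_or_eq_top (TwoSidedIdeal.comap f J)).resolve_left fun hbot ↦ hess J hJ ?_
    refine le_bot_iff.1 fun x hx ↦ ?_
    have hx' : (⟨x, hx.1⟩ : I) ∈ TwoSidedIdeal.comap f J := by
      rw [TwoSidedIdeal.mem_comap]; exact hx.2
    rw [hbot, TwoSidedIdeal.mem_bot] at hx'
    rw [TwoSidedIdeal.mem_bot]
    exact congrArg Subtype.val hx'
  intro x hx
  have : (⟨x, hx⟩ : I) ∈ TwoSidedIdeal.comap f J := by rw [hcomap]; trivial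
  rwa [TwoSidedIdeal.mem_comap] at this

/-- The infinite idempotents of an ideal, in terms of the ambient ring. -/
theorem IsInfiniteIdempotent.exists_coe {p : I} (hp : IsInfiniteIdempotent p) :
    ∃ x y : R, (p : R) * p = p ∧ y * x = p ∧ (p : R) * x = x ∧ x * p = x ∧ y * p = y ∧
      (p : R) * y = y ∧ (p : R) - x * y ≠ 0 := by
  obtain ⟨-, hpp, q, -, hqp, hpq, hne, x, y, ⟨a, ha⟩, ⟨b, hb⟩, hxy, hyx⟩ := hp
  have hpp' : p * p = p := hpp
  have h1 : p * x = x := by rw [ha, ← mul_assoc, ← mul_assoc, hpq]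
  have h2 : x * p = x := by rw [ha, mul_assoc, hpp']
  have h3 : y * p = y := by rw [hb, mul_assoc, hqp]
  have h4 : p * y = y := by rw [hb, ← mul_assoc, ← mul_assoc, hpp']
  refine ⟨x, y, congrArg Subtype.val hpp', congrArg Subtype.val hyx.symm, congrArg Subtype.val h1,
    congrArg Subtype.val h2, congrArg Subtype.val h3, congrArg Subtype.val h4, fun h0 ↦ hne ?_⟩
  rw [hxy]
  exact Subtype.ext (sub_eq_zero.1 h0).symm

theorem mem_span_singleton_of_ne_zero (hs : IsSimpleRing I) (hess : IsEssentialIdeal I) {c z : R}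
    (hc : c ≠ 0) (hz : z ∈ I) : z ∈ TwoSidedIdeal.span {c} := by
  refine le_of_ne_bot hs hess (fun h ↦ hc ?_) hz
  rw [← TwoSidedIdeal.mem_bot, ← h]
  exact TwoSidedIdeal.subset_span rfl

theorem IsPurelyInfiniteSimple.exists_isInfiniteIdempotent {A : Type*} [NonUnitalRing A]
    (h : IsPurelyInfiniteSimple A) : ∃ p : A, IsInfiniteIdempotent p := by
  have := h.1
  obtain ⟨x, hx⟩ : ∃ x : A, x ≠ 0 := by
    by_contra! h0
    exact bot_ne_top (TwoSidedIdeal.ext fun x ↦ by simp [h0 x] :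
      (⊥ : TwoSidedIdeal A) = ⊤)
  obtain ⟨p, -, hp⟩ := h.2 ⊤ (fun _ _ _ ↦ trivial) fun h0 ↦ hx <| by
    rw [← AddSubgroup.mem_bot, ← h0]; trivial
  exact ⟨p, hp⟩

/-- A ring with an essential purely infinite simple ideal is prime. -/
theorem eq_zero_or_eq_zero_of_forall_mul_mul_eq_zero (hpis : IsPurelyInfiniteSimple I)
    (hess : IsEssentialIdeal I) {u v : R} (h : ∀ r, u * r * v = 0) : u = 0 ∨ v = 0 := by
  by_contra! hne
  have h1 {z : R} (hz : z ∈ I) : ∀ r, z * r * v = 0 := by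
    have hz' := mem_span_singleton_of_ne_zero hpis.1 hess hne.1 hz
    clear hz
    induction hz' using TwoSidedIdeal.span_induction with
    | mem f hf => rw [Set.mem_singleton_iff] at hf; rwa [hf]
    | zero => simp
    | add a b _ _ ha hb => intro r; rw [add_mul, add_mul, ha, hb, add_zero]
    | neg a _ ha => intro r; rw [neg_mul, neg_mul, ha, neg_zero]
    | left_absorb c a _ ha => intro r; rw [mul_assoc c, mul_assoc c, ha, mul_zero]
    | right_absorb c a _ ha => intro r; rw [mul_assoc a, ha]
  have h2 {z : R} (hz : z ∈ I) : ∀ i ∈ I, i * z = 0 := by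
    have hz' := mem_span_singleton_of_ne_zero hpis.1 hess hne.2 hz
    clear hz
    induction hz' using TwoSidedIdeal.span_induction with
    | mem f hf =>
      rw [Set.mem_singleton_iff] at hf
      intro i hi
      rw [hf, ← h1 hi 1, mul_one]
    | zero => simp
    | add a b _ _ ha hb => intro i hi; rw [mul_add, ha i hi, hb i hi, add_zero]
    | neg a _ ha => intro i hi; rw [mul_neg, ha i hi, neg_zero]
    | left_absorb c a _ ha => intro i hi; rw [← mul_assoc, ha _ (I.mul_mem_right _ _ hi)]
    | right_absorb c a _ ha => intro i hi; rw [← mul_assoc, ha i hi, zero_mul]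
  obtain ⟨p, hp0, hp, -⟩ := hpis.exists_isInfiniteIdempotent
  exact hp0 (hp.symm.trans (Subtype.ext (h2 p.2 p p.2)))

/-- Elements of a purely infinite simple essential ideal factor through every non-zero element. -/
theorem exists_eq_mul_mul (hpis : IsPurelyInfiniteSimple I) (hess : IsEssentialIdeal I) {c z : R}
    (hc : c ≠ 0) (hz : z ∈ I) : ∃ x y : R, z = x * c * y := by
  -- The right ideal `c I`, non-zero by primeness, contains an infinite idempotent, which factors
  -- through `c`.
  let J : AddSubgroup I :=
    { carrier := {x | ∃ i ∈ I, (x : R) = c * i}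
      add_mem' := by
        rintro a b ⟨i, hi, ha⟩ ⟨j, hj, hb⟩
        exact ⟨i + j, I.add_mem hi hj, by rw [mul_add, ← ha, ← hb]; rfl⟩
      zero_mem' := ⟨0, I.zero_mem, by rw [mul_zero]; rfl⟩
      neg_mem' := by
        rintro a ⟨i, hi, ha⟩
        exact ⟨-i, I.neg_mem hi, by rw [mul_neg, ← ha]; rfl⟩ }
  have hJ : IsRightIdeal J := by
    rintro x ⟨i, hi, hx⟩ a
    exact ⟨i * a, I.mul_mem_right _ _ hi, by rw [← mul_assoc, ← hx]; rfl⟩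
  have hJ0 : J ≠ ⊥ := by
    intro h0
    have hcI {i : R} (hi : i ∈ I) : c * i = 0 := by
      have : (⟨c * i, I.mul_mem_left _ _ hi⟩ : I) ∈ J := ⟨i, hi, rfl⟩
      rw [h0, AddSubgroup.mem_bot] at this
      exact congrArg Subtype.val this
    obtain ⟨e, he0, -⟩ := hpis.exists_isInfiniteIdempotent
    refine (eq_zero_or_eq_zero_of_forall_mul_mul_eq_zero hpis hess (u := c) (v := e)
      fun r ↦ ?_).elim hc fun he ↦ he0 (Subtype.ext he)
    rw [mul_assoc]
    exact hcI (I.mul_mem_left _ _ e.2)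
  obtain ⟨p, ⟨i, -, hpi⟩, hp⟩ := hpis.2 J hJ hJ0
  obtain ⟨x, y, hpp, hyx, hpx, hxp, hyp, hpy, hne⟩ := hp.exists_coe
  obtain ⟨a, b, hab⟩ := exists_eq_mul_mul_of_mem_span hpp hyx hpx hxp hyp hpy
    (mem_span_singleton_of_ne_zero hpis.1 hess hne hz)
  exact ⟨a, i * b, by rw [hab, hpi]; simp only [mul_assoc]⟩

/-- In a ring with an essential purely infinite simple ideal, quasi-invertible elements are
one-sided invertible. -/
theorem IsQuasiInvertible.mem_or_mem (hpis : IsPurelyInfiniteSimple I) (hess : IsEssentialIdeal I)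
    {u : R} (hu : IsQuasiInvertible u) : (∃ v, u * v = 1) ∨ ∃ v, v * u = 1 := by
  obtain ⟨v, hv⟩ := hu
  exact (eq_zero_or_eq_zero_of_forall_mul_mul_eq_zero hpis hess fun r ↦ (hv r).1).imp
    (fun h ↦ ⟨v, (sub_eq_zero.1 h).symm⟩) fun h ↦ ⟨v, (sub_eq_zero.1 h).symm⟩

/-! ### Lifting one-sided invertibility modulo an exchange ideal -/

/-- The exchange property of an ideal, in terms of the ambient ring. -/
theorem IsExchangeRing.exists_isIdempotentElem (hexch : IsExchangeRing I) {b : R} (hb : b ∈ I) :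
    ∃ r s : R, IsIdempotentElem (b * r) ∧ 1 - b * r = (1 - b) * s := by
  obtain ⟨p, r, s, hp, hpr, hps⟩ := hexch ⟨b, hb⟩
  have hpr' : (p : R) = b * r := congrArg Subtype.val hpr
  have hps' : (p : R) = b + s - b * s := congrArg Subtype.val hps
  refine ⟨r, 1 - s, ?_, ?_⟩
  · rw [← hpr']; exact congrArg Subtype.val hp
  · rw [← hpr', hps']; noncomm_ring

/-- Comaximality rewrites the defect of `a` as `c z b`, in both `I` and `R b`. The left form of
exchange then puts the idempotent in `R b`, so correcting by its left multiples is allowed. -/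
theorem exists_isQuasiInvertible_of_left (hpis : IsPurelyInfiniteSimple I)
    (hess : IsEssentialIdeal I) (hexch : IsExchangeRing I) {a b x z t : R}
    (hab : x * a + z * b = 1) (ht : 1 - t * a ∈ I) :
    ∃ y : R, IsQuasiInvertible (a + y * b) := by
  set c := 1 - t * a with hc
  have hb : c * z * b ∈ I := I.mul_mem_right _ _ (I.mul_mem_right _ _ ht)
  have hsum : (t + c * x) * a = 1 - c * z * b := by
    have : (t + c * x) * a + c * z * b = t * a + c * (x * a + z * b) := by noncomm_ring
    rw [hab, hc] at this
    rw [eq_sub_iff_add_eq, this]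
    noncomm_ring
  obtain ⟨r, s, hp, hs⟩ := hexch.exists_isIdempotentElem hb
  obtain ⟨u, v, hu, huv⟩ := exists_isIdempotentElem_left hp hs
  obtain ⟨w, hw⟩ := exists_isQuasiInvertible_add_mul (a := a) (t := v * (t + c * x)) hu
    (by rw [mul_assoc, hsum, huv])
    (fun d hd ↦ exists_eq_mul_mul hpis hess hd (I.mul_mem_left _ _ hb))
  exact ⟨w * (u * (c * z)), by simpa only [mul_assoc] using hw⟩

theorem exists_isQuasiInvertible_of_right (hpis : IsPurelyInfiniteSimple I)
    (hess : IsEssentialIdeal I) (hexch : IsExchangeRing I) {a b x z t : R}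
    (hab : x * a + z * b = 1) (ht : 1 - a * t ∈ I) :
    ∃ y : R, IsQuasiInvertible (a + y * b) := by
  obtain ⟨r, s, hp, hs⟩ := hexch.exists_isIdempotentElem ht
  refine exists_isQuasiInvertible_add_mul' (t := t * s) hp ?_ hab
    (fun d hd ↦ exists_eq_mul_mul hpis hess hd (I.mul_mem_right _ _ ht))
  rw [hs, ← mul_assoc, sub_sub_cancel]

/-! ### QB-rings and quotients -/

/-- A quotient of a QB-ring is a QB-ring. -/
theorem IsQBRing.of_surjective {S : Type*} [Ring S] (hR : IsQBRing R) (f : R →+* S)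
    (hf : Function.Surjective f) : IsQBRing S := by
  rw [isQBRing_iff] at hR ⊢
  intro a b x z h
  obtain ⟨a, rfl⟩ := hf a
  obtain ⟨b, rfl⟩ := hf b
  obtain ⟨x, rfl⟩ := hf x
  obtain ⟨z, rfl⟩ := hf z
  -- The relation need not hold for the lifts; `1 - x a` is comaximal with `a` and maps to a left
  -- multiple of the given `b`.
  obtain ⟨y, v, hv⟩ := hR a (1 - x * a) x 1 (by noncomm_ring)
  have hb : f (1 - x * a) = f z * f b := by
    rw [map_sub, map_mul, map_one, ← h]; noncomm_ring
  refine ⟨f y * f z, f v, fun r ↦ ?_⟩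
  obtain ⟨r, rfl⟩ := hf r
  have h1 := congrArg f (hv r).1
  have h2 := congrArg f (hv r).2
  simp only [map_mul, map_sub, map_one, map_add, map_zero] at h1 h2 hb
  rw [hb, ← mul_assoc] at h1 h2
  exact ⟨h1, h2⟩

/-- Quasi-invertible elements of a quotient of a QB-ring lift to quasi-invertible elements, up to a
unit factor on the right. -/
theorem IsQBRing.exists_isQuasiInvertible_map_eq {S : Type*} [Ring S] (hR : IsQBRing R)
    (f : R →+* S) (hf : Function.Surjective f) {u : S} (hu : IsQuasiInvertible u) :
    ∃ (a : R) (s : Sˣ), IsQuasiInvertible a ∧ f a = u * s := by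
  obtain ⟨v, huv, hv⟩ := hu.exists_regular
  obtain ⟨a, rfl⟩ := hf u
  obtain ⟨b, rfl⟩ := hf v
  obtain ⟨y, hy⟩ := isQBRing_iff.1 hR a (1 - b * a) b 1 (by noncomm_ring)
  obtain ⟨s, hs⟩ := exists_unit_mul_eq huv hv (f y)
  exact ⟨_, s, hy, by simpa using hs⟩

end Ideal

end QBRings

/-! ### The extension theorem -/

theorem theorem1p13 {R : Type*} [Ring R] (I : TwoSidedIdeal R)
    (hpis : QBRings.IsPurelyInfiniteSimple I)
    (hess : QBRings.IsEssentialIdeal I)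
    (hexch : QBRings.IsExchangeRing I) :
    QBRings.IsQBRing R ↔
      QBRings.IsQBRing I.ringCon.Quotient ∧
        QBRings.quasiInvertibles I.ringCon.Quotient =
          QBRings.rightInvertibles I.ringCon.Quotient ∪
            QBRings.leftInvertibles I.ringCon.Quotient := by
  have hf : Function.Surjective I.ringCon.mk' := I.ringCon.mk'_surjective
  have hmem {x : R} : 1 - x ∈ I ↔ I.ringCon.mk' x = 1 := by
    rw [← TwoSidedIdeal.rel_iff, ← map_one I.ringCon.mk', eq_comm]
    exact (RingCon.eq _).symm
  constructor
  · intro hR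
    refine ⟨hR.of_surjective _ hf, Set.Subset.antisymm (fun u hu ↦ ?_) ?_⟩
    · obtain ⟨a, s, ha, has⟩ := hR.exists_isQuasiInvertible_map_eq _ hf hu
      refine (ha.mem_or_mem hpis hess).imp (fun ⟨v, hv⟩ ↦ ?_) fun ⟨v, hv⟩ ↦ ?_
      · exact ⟨s * I.ringCon.mk' v, by rw [← mul_assoc, ← has, ← map_mul, hv, map_one]⟩
      · refine ⟨s * I.ringCon.mk' v, ?_⟩
        have hu : u = I.ringCon.mk' a * ↑s⁻¹ := by rw [has, Units.mul_inv_cancel_right]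
        rw [hu, mul_assoc, ← mul_assoc (I.ringCon.mk' v), ← map_mul, hv, map_one, one_mul,
          Units.mul_inv]
    · rintro u (⟨v, hv⟩ | ⟨v, hv⟩)
      · exact QBRings.isQuasiInvertible_of_mul_eq_one hv
      · exact QBRings.isQuasiInvertible_of_mul_eq_one' hv
  · rintro ⟨hQ, hinv⟩
    rw [QBRings.isQBRing_iff] at hQ ⊢
    intro a b x z hab
    obtain ⟨y, hy⟩ := hQ (I.ringCon.mk' a) (I.ringCon.mk' b) (I.ringCon.mk' x) (I.ringCon.mk' z)
      (by rw [← map_mul, ← map_mul, ← map_add, hab, map_one])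
    obtain ⟨y, rfl⟩ := hf y
    rw [← map_mul, ← map_add] at hy
    -- Comaximality with `b` survives replacing `a` by `a + y b`.
    have hab' : x * (a + y * b) + (z - x * y) * b = 1 := by rw [← hab]; noncomm_ring
    have hy' : I.ringCon.mk' (a + y * b) ∈ QBRings.rightInvertibles I.ringCon.Quotient ∪
        QBRings.leftInvertibles I.ringCon.Quotient := hinv ▸ hy
    suffices ∃ w, QBRings.IsQuasiInvertible (a + y * b + w * b) by
      obtain ⟨w, hw⟩ := this
      exact ⟨y + w, by rwa [add_mul, ← add_assoc]⟩
    rcases hy' with ⟨v, hv⟩ | ⟨v, hv⟩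
    all_goals obtain ⟨v, rfl⟩ := hf v
    · exact QBRings.exists_isQuasiInvertible_of_right hpis hess hexch hab'
        (hmem.2 (by rw [map_mul, hv]) : 1 - (a + y * b) * v ∈ I)
    · exact QBRings.exists_isQuasiInvertible_of_left hpis hess hexch hab'
        (hmem.2 (by rw [map_mul, hv]) : 1 - v * (a + y * b) ∈ I)
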